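/- Let $n\ge 1$ and let $\Omega\subset\mathbb R^n$ be a bounded domain (nonempty, connected, open) with $C^2$ boundary. Let $A=\Delta$ be the Dirichlet Laplacian on the real space $L^2(\Omega)$, with domain $D(A)=H^2(\Omega)\cap H^1_0(\Omega)$. Let $c>0$, $\alpha\in\mathbb R$ and $M(t)=ce^{\alpha t}$ for $t\ge 0$. For $y_0\in L^2(\Omega)$, consider the heat equation with memory $$\begin{cases}\partial_t y(t,x)-\Delta y(t,x)+\int_0^t M(t-s)\,y(s,x)\,ds=0, & t>0,\ x\in\Omega,\\ y(t,x)=0, & t>0,\ x\in\partial\Omega,\\ y(0,x)=y_0(x), & x\in\Omega,\end{cases}$$ whose solution $y(\cdot;y_0)\in C([0,\infty);L^2(\Omega))$ is understood in the mild sense: for every $t\ge 0$, $\int_0^t y(s)\,ds\in D(A)$ and $$y(t)=y_0+A\int_0^t y(s)\,ds-\int_0^t\int_0^s M(s-r)\,y(r)\,dr\,ds .$$ Let $t_1,t_2>0$ satisfy $0<t_2-t_1<\pi/\sqrt c$. Then the equation has backward uniqueness at $\{t_1,t_2\}$: for every $y_0\in L^2(\Omega)$, if $y(t_1;y_0)=0$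 and $y(t_2;y_0)=0$ in $L^2(\Omega)$, then $y_0=0$ in $L^2(\Omega)$. -/

import Mathlib

open MeasureTheory Filter Topology Set

noncomputable section

namespace HeatMemory

/-- The Euclidean space `ℝⁿ`. -/
abbrev Space (n : ℕ) : Type := EuclideanSpace ℝ (Fin n)

/-- The real Hilbert space `L²(Ω)`, with respect to Lebesgue measure. -/
abbrev L2 {n : ℕ} (Ω : Set (Space n)) : Type := Lp ℝ 2 (volume.restrict Ω)

/-- The classical partial derivative `∂ᵢ φ`. -/
def partialDeriv {n : ℕ} (i : Fin n) (φ : Space n → ℝ) (x : Space n) : ℝ :=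
  fderiv ℝ φ x (EuclideanSpace.single i 1)

/-- `Ω` has `C²` boundary: near every boundary point, `Ω` is the set where some `C²` function
with nonvanishing differential is negative. -/
def HasC2Boundary {n : ℕ} (Ω : Set (Space n)) : Prop :=
  ∀ x₀ ∈ frontier Ω, ∃ (U : Set (Space n)) (ρ : Space n → ℝ),
    IsOpen U ∧ x₀ ∈ U ∧ ContDiffOn ℝ 2 ρ U ∧ (∀ x ∈ U, fderiv ℝ ρ x ≠ 0) ∧
      Ω ∩ U = {x ∈ U | ρ x < 0}

/-- A bounded domain (nonempty connected open set) with `C²` boundary. -/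
structure IsBoundedC2Domain {n : ℕ} (Ω : Set (Space n)) : Prop where
  isOpen : IsOpen Ω
  isConnected : IsConnected Ω
  isBounded : Bornology.IsBounded Ω
  boundary : HasC2Boundary Ω

/-- `φ ∈ C_c^∞(Ω)`. -/
structure IsTestFunction {n : ℕ} (Ω : Set (Space n)) (φ : Space n → ℝ) : Prop where
  smooth : ContDiff ℝ (⊤ : ℕ∞) φ
  compact : HasCompactSupport φ
  support : tsupport φ ⊆ Ω

/-- `g` is the weak partial derivative `∂ᵢ f` on `Ω`. -/
def HasWeakPartial {n : ℕ} (Ω : Set (Space n)) (i : Fin n) (f g : L2 Ω) : Prop :=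
  ∀ φ : Space n → ℝ, IsTestFunction Ω φ →
    ∫ x in Ω, f x * partialDeriv i φ x = - ∫ x in Ω, g x * φ x

/-- `f ∈ H¹₀(Ω)`, the closure of `C_c^∞(Ω)` in `H¹(Ω)`: the function `f` has a weak gradient
`g ∈ L²(Ω)ⁿ`, and some sequence of test functions converges to `f` in `L²(Ω)`, with gradients
converging to `g` in `L²(Ω)ⁿ`. -/
def MemH10 {n : ℕ} (Ω : Set (Space n)) (f : L2 Ω) : Prop :=
  ∃ g : Fin n → L2 Ω, (∀ i, HasWeakPartial Ω i f (g i)) ∧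
    ∃ φ : ℕ → Space n → ℝ, (∀ k, IsTestFunction Ω (φ k)) ∧
      Tendsto (fun k => eLpNorm (fun x => φ k x - f x) 2 (volume.restrict Ω)) atTop (𝓝 0) ∧
      ∀ i, Tendsto (fun k => eLpNorm (fun x => partialDeriv i (φ k) x - g i x) 2
        (volume.restrict Ω)) atTop (𝓝 0)

/-- `f ∈ H²(Ω)` and `Δ f = u`: all weak partial derivatives of `f` of first and second order exist
in `L²(Ω)`, and `u` is the sum of the pure second ones. -/
def IsH2WithLaplacian {n : ℕ} (Ω : Set (Space n)) (f u : L2 Ω) : Prop :=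
  ∃ (g : Fin n → L2 Ω) (h : Fin n → Fin n → L2 Ω),
    (∀ i, HasWeakPartial Ω i f (g i)) ∧ (∀ i j, HasWeakPartial Ω j (g i) (h i j)) ∧
      u = ∑ i, h i i

/-- The graph of the Dirichlet Laplacian `A = Δ` with domain `D(A) = H²(Ω) ∩ H¹₀(Ω)`:
`f ∈ D(A)` and `A f = u`. -/
def DirichletLaplacian {n : ℕ} (Ω : Set (Space n)) (f u : L2 Ω) : Prop :=
  MemH10 Ω f ∧ IsH2WithLaplacian Ω f u

/-- `y ∈ C([0,∞); L²(Ω))` is the (mild) solution of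
`∂ₜ y - Δ y + ∫₀ᵗ M(t - s) y(s) ds = 0`, `y = 0` on `∂Ω`, `y(0) = y₀`: for all `t ≥ 0`,
`∫₀ᵗ y(s) ds ∈ D(A)` and
`y(t) = y₀ + A ∫₀ᵗ y(s) ds - ∫₀ᵗ ∫₀ˢ M(s - r) y(r) dr ds`.
Values of `y` and `M` at negative times play no role. -/
structure IsSolution {n : ℕ} (Ω : Set (Space n)) (M : ℝ → ℝ) (y₀ : L2 Ω) (y : ℝ → L2 Ω) :
    Prop where
  continuousOn : ContinuousOn y (Ici 0)
  initial : y 0 = y₀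
  equation : ∀ t : ℝ, 0 ≤ t →
    DirichletLaplacian Ω (∫ s in (0 : ℝ)..t, y s)
      (y t - y₀ + ∫ s in (0 : ℝ)..t, ∫ r in (0 : ℝ)..s, M (s - r) • y r)

/-- The heat equation with memory kernel `M` on `Ω` has backward uniqueness at the times
`t₁, …, tₘ`: the solution with initial datum `y₀` can vanish in `L²(Ω)` at all of these times only
if `y₀ = 0`. -/
def HasBackwardUniqueness {n : ℕ} (Ω : Set (Space n)) (M : ℝ → ℝ) {m : ℕ} (t : Fin m → ℝ) :
    Prop :=
  ∀ (y₀ : L2 Ω) (y : ℝ → L2 Ω), IsSolution Ω M y₀ y → (∀ j, y (t j) = 0) → y₀ = 0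

end HeatMemory

end

/-!
Write `w' = -L w - c z`, `z' = α z + w` for the equation with memory, where `L = -Δ` and
`z(t) = ∫₀ᵗ e^{α(t-s)} w(s) ds`. If `L` is bounded and symmetric and `B = L + α`, the function
`p = e^{-αt} e^{tB/2} w` satisfies `p'' = (B² / 4 - c) p`. Every mode of `p` thus oscillates at most
as fast as `sin (√c t)`, whose zeros are `π / √c` apart, so that two zeros of `p` which are closer
to each other force `p'`, hence `z`, to vanish at `t₁` as well
(`deriv_eq_zero_of_two_zeros`, `bounded_backward_uniqueness`). The Cauchy problem for `(w, z)` with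
zero data at `t₁` then gives `w(0) = 0`.

The Laplacian is unbounded, and `e^{tB/2}` makes no sense for it. The equation is therefore first
projected onto a part of the spectrum on which `Δ` is bounded. For this only the resolvent
`T = (1 - Δ)⁻¹` is needed, through two properties: it is self-adjoint and injective, and
`T (f - Δ f) = f` on the domain of the Dirichlet Laplacian (`resolvent_sub_laplacian`). The continuous
functional calculus of `T` provides operators `P` close to `T²` on whose range `T` has a bounded
inverse (`exists_spectral_truncation`). The truncated solution `P y` solves the equation with a
bounded generator, so `P y₀ = 0`; letting `P` tend to `T²` gives `T² y₀ = 0` and `y₀ = 0`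
(`backward_uniqueness_of_resolvent`).

The resolvent is `T = J J†`, where `J` is the embedding of `H¹₀` into `L²`. Neither the compactness
of `J` nor elliptic regularity enters. Complex scalars appear because the functional calculus is that
of operators on a complex Hilbert space.
-/

noncomputable section

namespace HeatMemory

/-! ### The memory equation with a bounded generator -/

section BoundedGenerator

variable {H : Type*} [NormedAddCommGroup H] [InnerProductSpace ℝ H]

theorem hasDerivAt_neg_mul_tan {k m t : ℝ} (h : Real.cos (k * (t - m)) ≠ 0) :
    HasDerivAt (fun s => -k * Real.tan (k * (s - m)))
      (-(-k * Real.tan (k * (t - m))) ^ 2 - k ^ 2) t := by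
  have h1 : HasDerivAt (fun s : ℝ => k * (s - m)) k t := by
    simpa using ((hasDerivAt_id t).sub_const m).const_mul k
  have h2 := ((Real.hasDerivAt_tan h).comp t h1).const_mul (-k)
  refine h2.congr_deriv ?_
  rw [Real.tan_eq_sin_div_cos]
  field_simp
  linear_combination k ^ 2 * Real.sin_sq_add_cos_sq (k * (t - m))

/-- A Hilbert space valued Sturm comparison: if `p'' = (B² / 4 - c) p` with `B` symmetric, and `p`
vanishes at two points at distance less than `π / √c`, then `p'` vanishes at the first of them.
The reason is Picone's identity
`(⟪p', p⟫ - φ ‖p‖²)' = ‖p' - φ p‖² + ‖B p‖² / 4`, where `φ` solves the Riccati equation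
`φ' = -φ² - c` on the whole interval. -/
theorem deriv_eq_zero_of_two_zeros (B : H →L[ℝ] H)
    (hB : ∀ x y, inner ℝ (B x) y = inner ℝ x (B y)) {c t₁ t₂ : ℝ} (hc : 0 < c) (hlt : t₁ < t₂)
    (hgap : t₂ - t₁ < Real.pi / Real.sqrt c) {p q : ℝ → H}
    (hp : ∀ t ∈ Icc t₁ t₂, HasDerivAt p (q t) t)
    (hq : ∀ t ∈ Icc t₁ t₂, HasDerivAt q ((1 / 4 : ℝ) • B (B (p t)) - c • p t) t)
    (h₁ : p t₁ = 0) (h₂ : p t₂ = 0) : q t₁ = 0 := by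
  set k := Real.sqrt c with hk
  have hkpos : 0 < k := Real.sqrt_pos.2 hc
  have hk2 : k ^ 2 = c := Real.sq_sqrt hc.le
  set m := (t₁ + t₂) / 2 with hm
  set φ : ℝ → ℝ := fun s => -k * Real.tan (k * (s - m)) with hφ
  -- On the interval the argument of the tangent stays in `(-π / 2, π / 2)`.
  have hcos : ∀ t ∈ Icc t₁ t₂, Real.cos (k * (t - m)) ≠ 0 := by
    intro t ht
    rw [lt_div_iff₀ hkpos] at hgap
    apply (Real.cos_pos_of_mem_Ioo ⟨?_, ?_⟩).ne'
    · have := mul_le_mul_of_nonneg_left ht.1 hkpos.le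
      rw [hm]; linarith
    · have := mul_le_mul_of_nonneg_left ht.2 hkpos.le
      rw [hm]; linarith
  set G : ℝ → ℝ := fun t => inner ℝ (q t) (p t) - φ t * inner ℝ (p t) (p t) with hG
  have hGd : ∀ t ∈ Icc t₁ t₂,
      HasDerivAt G (‖q t - φ t • p t‖ ^ 2 + (1 / 4) * ‖B (p t)‖ ^ 2) t := by
    intro t ht
    have hφd := hasDerivAt_neg_mul_tan (hcos t ht)
    rw [hk2] at hφd
    have := ((hq t ht).inner ℝ (hp t ht)).sub (hφd.mul ((hp t ht).inner ℝ (hp t ht)))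
    refine this.congr_deriv ?_
    change _ + _ - ((-(φ t) ^ 2 - c) * _ + φ t * _) = _
    rw [← real_inner_self_eq_norm_sq, ← real_inner_self_eq_norm_sq]
    simp only [inner_sub_left, inner_sub_right, real_inner_smul_left, real_inner_smul_right, hB]
    rw [real_inner_comm (p t) (q t)]
    ring
  have hcont : ContinuousOn G (Icc t₁ t₂) := fun t ht => (hGd t ht).continuousAt.continuousWithinAt
  have hmono : MonotoneOn G (Icc t₁ t₂) := by
    refine monotoneOn_of_deriv_nonneg (convex_Icc _ _) hcont ?_ ?_
    · intro t ht
      exact (hGd t (interior_subset ht)).differentiableAt.differentiableWithinAt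
    · intro t ht
      rw [(hGd t (interior_subset ht)).deriv]
      positivity
  have hG1 : G t₁ = 0 := by simp [hG, h₁]
  have hG2 : G t₂ = 0 := by simp [hG, h₂]
  have hmem : t₁ ∈ Icc t₁ t₂ := left_mem_Icc.2 hlt.le
  have hG0 : ∀ t ∈ Icc t₁ t₂, G t = 0 := fun t ht => le_antisymm
    (hG2 ▸ hmono ht (right_mem_Icc.2 hlt.le) ht.2) (hG1 ▸ hmono hmem ht ht.1)
  have hd0 : HasDerivWithinAt G 0 (Icc t₁ t₂) t₁ :=
    (hasDerivWithinAt_const t₁ _ (0 : ℝ)).congr hG0 hG1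
  have := (uniqueDiffOn_Icc hlt t₁ hmem).eq_deriv _ (hGd t₁ hmem).hasDerivWithinAt hd0
  simpa [h₁] using this

variable [CompleteSpace H]

/-- Backward uniqueness for `w' = -L w - c z`, `z' = α z + w` with a bounded symmetric `L`.
With `B = L + α`, the function `p = e^{-αt} e^{tB/2} w` satisfies `p'' = (B² / 4 - c) p`, so the
Sturm comparison applies to it. -/
theorem bounded_backward_uniqueness (L : H →L[ℝ] H)
    (hL : ∀ x y, inner ℝ (L x) y = inner ℝ x (L y)) {c α t₁ t₂ : ℝ} (hc : 0 < c) (ht₁ : 0 < t₁)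
    (hlt : t₁ < t₂) (hgap : t₂ - t₁ < Real.pi / Real.sqrt c) {w z : ℝ → H}
    (hw : ∀ t, 0 ≤ t → HasDerivAt w (-L (w t) - c • z t) t)
    (hz : ∀ t, 0 ≤ t → HasDerivAt z (α • z t + w t) t)
    (h₁ : w t₁ = 0) (h₂ : w t₂ = 0) : w 0 = 0 := by
  set B : H →L[ℝ] H := L + α • ContinuousLinearMap.id ℝ H with hBdef
  have hB : ∀ x y, inner ℝ (B x) y = inner ℝ x (B y) := by
    intro x y
    simp [hBdef, inner_add_left, inner_add_right, hL, real_inner_smul_left, real_inner_smul_right]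
  have hLB : ∀ x, L x = B x - α • x := by intro x; simp [hBdef]
  set A : H →L[ℝ] H := (1 / 2 : ℝ) • B - α • ContinuousLinearMap.id ℝ H with hA
  set E : ℝ → H →L[ℝ] H := fun t => NormedSpace.exp (t • A) with hE
  have hEd : ∀ t, HasDerivAt E (E t * A) t := fun t => hasDerivAt_exp_smul_const (𝕂 := ℝ) A t
  have hEA : ∀ t x, (E t * A) x = E t (A x) := fun _ _ => rfl
  have hAx : ∀ x, A x = (1 / 2 : ℝ) • B x - α • x := fun _ => rfl
  have hcomm : ∀ t, Commute (E t) B := by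
    intro t
    refine Commute.exp_left (Commute.smul_left ?_ t)
    refine Commute.sub_left (Commute.smul_left (Commute.refl _) _) (Commute.smul_left ?_ _)
    exact Commute.one_left B
  have hcomm' : ∀ t x, B (E t x) = E t (B x) := fun t x =>
    (DFunLike.congr_fun (hcomm t).eq x).symm
  set p : ℝ → H := fun t => E t (w t) with hp
  set q : ℝ → H := fun t => -(E t ((1 / 2 : ℝ) • B (w t) + c • z t)) with hq
  have hpd : ∀ t, 0 ≤ t → HasDerivAt p (q t) t := by
    intro t ht
    refine ((hEd t).clm_apply (hw t ht)).congr_deriv ?_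
    simp only [hq, hEA, hAx, hLB, map_add, map_sub, map_neg, map_smul]
    module
  have hqd : ∀ t, 0 ≤ t → HasDerivAt q ((1 / 4 : ℝ) • B (B (p t)) - c • p t) t := by
    intro t ht
    have hinner : HasDerivAt (fun t => (1 / 2 : ℝ) • B (w t) + c • z t)
        ((1 / 2 : ℝ) • B (-L (w t) - c • z t) + c • (α • z t + w t)) t :=
      ((B.hasFDerivAt.comp_hasDerivAt t (hw t ht)).const_smul _).add ((hz t ht).const_smul c)
    refine ((hEd t).clm_apply hinner).neg.congr_deriv ?_
    simp only [hp, hEA, hcomm', hAx, hLB, map_add, map_sub, map_neg, map_smul]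
    module
  have hq1 : q t₁ = 0 := deriv_eq_zero_of_two_zeros B hB hc hlt hgap
    (fun t ht => hpd t (ht₁.le.trans ht.1)) (fun t ht => hqd t (ht₁.le.trans ht.1))
    (by simp [hp, h₁]) (by simp [hp, h₂])
  have hEinv : ∀ t x, E t x = 0 → x = 0 := by
    intro t x hx
    let _ := NormedAlgebra.restrictScalars ℚ ℝ (H →L[ℝ] H)
    obtain ⟨u, hu⟩ := NormedSpace.isUnit_exp (t • A)
    have h : (↑u⁻¹ : H →L[ℝ] H) (E t x) = x := by
      change (↑u⁻¹ * NormedSpace.exp (t • A) : H →L[ℝ] H) x = x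
      rw [← hu, Units.inv_mul]; rfl
    rw [← h, hx, map_zero]
  have hz1 : z t₁ = 0 := by
    have := hEinv t₁ _ (neg_eq_zero.1 hq1)
    simpa [h₁, hc.ne'] using this
  -- The Cauchy problem for `(w, z)` with data at `t₁` is solved uniquely backwards in time.
  set V : H × H →L[ℝ] H × H :=
    ((-L).coprod (-(c • ContinuousLinearMap.id ℝ H))).prod
      ((ContinuousLinearMap.id ℝ H).coprod (α • ContinuousLinearMap.id ℝ H)) with hV
  have huniq : EqOn (fun t => (w t, z t)) (fun _ => (0 : H × H)) (Icc 0 t₁) := by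
    have hd : ∀ t, 0 ≤ t → HasDerivAt (fun t => (w t, z t)) (V (w t, z t)) t := by
      intro t ht
      refine ((hw t ht).prodMk (hz t ht)).congr_deriv ?_
      simp [hV, sub_eq_add_neg, add_comm]
    refine ODE_solution_unique_of_mem_Icc_left (v := fun _ => V) (s := fun _ => univ)
      (fun _ _ => V.lipschitz.lipschitzOnWith)
      (fun t ht => (hd t ht.1).continuousAt.continuousWithinAt)
      (fun t ht => (hd t ht.1.le).hasDerivWithinAt) (fun _ _ => mem_univ _)
      continuousOn_const (fun t _ => ?_) (fun _ _ => mem_univ _) (by simp [h₁, hz1])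
    simpa using hasDerivWithinAt_const t (Iic t) (0 : H × H)
  exact congrArg Prod.fst (huniq (left_mem_Icc.2 ht₁.le))

end BoundedGenerator

/-! ### Spectral truncation -/

section SelfAdjoint

variable {H : Type*} [NormedAddCommGroup H] [InnerProductSpace ℂ H] [CompleteSpace H]

theorem div_max_mul_max_sub {ε : ℝ} (hε : 0 < ε) (x : ℝ) :
    x / max (x ^ 2) ε * (max (x ^ 2 - ε) 0 * x) = max (x ^ 2 - ε) 0 := by
  rcases le_total (x ^ 2) ε with h | h
  · simp [h]
  · rw [max_eq_left h, max_eq_left (sub_nonneg.2 h)]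
    have : x ≠ 0 := by rintro rfl; norm_num at h; linarith
    field_simp

/-- A self-adjoint operator `T` can be truncated spectrally to the region `|x| ≥ √ε`, where it is
bounded below: `P = h(T)` with `h(x) = max (x² - ε) 0` is close to `T²`, and on the range of `P`
the operator `K = k(T)`, `k(x) = x / max (x²) ε`, is an inverse of `T`. -/
theorem exists_spectral_truncation (T : H →L[ℂ] H) (hT : IsSelfAdjoint T) {ε : ℝ} (hε : 0 < ε) :
    ∃ P K : H →L[ℂ] H, IsSelfAdjoint K ∧ (∀ x, K (P (T x)) = P x) ∧ ‖P - T ^ 2‖ ≤ ε := by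
  have hkc : Continuous fun x : ℝ => x / max (x ^ 2) ε :=
    continuous_id.div (by fun_prop) fun x => (lt_of_lt_of_le hε (le_max_right _ _)).ne'
  have hhc : Continuous fun x : ℝ => max (x ^ 2 - ε) 0 := by fun_prop
  have hhx : Continuous fun x : ℝ => max (x ^ 2 - ε) 0 * x := by fun_prop
  refine ⟨cfc (fun x : ℝ => max (x ^ 2 - ε) 0) T, cfc (fun x : ℝ => x / max (x ^ 2) ε) T,
    cfc_predicate _ T, fun x => ?_, ?_⟩
  · have h : cfc (fun x : ℝ => x / max (x ^ 2) ε) T * (cfc (fun x : ℝ => max (x ^ 2 - ε) 0) T * T) =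
        cfc (fun x : ℝ => max (x ^ 2 - ε) 0) T := by
      conv_lhs =>
        enter [2, 2]
        rw [← cfc_id' ℝ T]
      rw [← cfc_mul _ _ T hhc.continuousOn (continuousOn_id' _),
        ← cfc_mul _ _ T hkc.continuousOn hhx.continuousOn]
      simp_rw [div_max_mul_max_sub hε]
    exact DFunLike.congr_fun h x
  · rw [← cfc_pow_id (R := ℝ) T 2, ← cfc_sub _ _ T hhc.continuousOn (by fun_prop)]
    refine norm_cfc_le hε.le fun x _ => ?_
    rw [Real.norm_eq_abs, abs_le]
    rcases le_total (x ^ 2 - ε) 0 with h | h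
    · rw [max_eq_right h]; constructor <;> nlinarith [sq_nonneg x]
    · rw [max_eq_left h]; constructor <;> linarith

/-- The exponential kernel factors, so the memory term solves a differential equation of its own. -/
theorem memory_integral_eq {E : Type*} [NormedAddCommGroup E] [NormedSpace ℝ E] (c α t : ℝ)
    (y : ℝ → E) :
    ∫ s in (0 : ℝ)..t, ∫ r in (0 : ℝ)..s, (c * Real.exp (α * (s - r))) • y r =
      c • ∫ s in (0 : ℝ)..t, Real.exp (α * s) • ∫ r in (0 : ℝ)..s, Real.exp (-(α * r)) • y r := by
  rw [← intervalIntegral.integral_smul]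
  congr 1; ext s
  rw [smul_smul, ← intervalIntegral.integral_smul]
  congr 1; ext r
  rw [smul_smul, mul_assoc, ← Real.exp_add]
  congr 3; ring

variable {E : Type*} [NormedAddCommGroup E] [NormedSpace ℝ E] [CompleteSpace E]

/-- After a spectral truncation `Q = P ∘ ι` a mild solution of the memory equation solves the
equation with a bounded generator, so it vanishes at time `0` if it vanishes at `t₁` and `t₂`. -/
theorem truncated_initial_eq_zero (Q : E →L[ℝ] H) (K : H →L[ℂ] H) (hK : IsSelfAdjoint K)
    {c α t₁ t₂ : ℝ} (hc : 0 < c) (ht₁ : 0 < t₁) (hlt : t₁ < t₂)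
    (hgap : t₂ - t₁ < Real.pi / Real.sqrt c) {y : ℝ → E} (hy : Continuous y)
    (heq : ∀ t, 0 ≤ t → Q ((∫ s in (0 : ℝ)..t, y s) - (y t - y 0 +
      ∫ s in (0 : ℝ)..t, ∫ r in (0 : ℝ)..s, (c * Real.exp (α * (s - r))) • y r)) =
        K (Q (∫ s in (0 : ℝ)..t, y s)))
    (h₁ : y t₁ = 0) (h₂ : y t₂ = 0) : Q (y 0) = 0 := by
  let _ : InnerProductSpace ℝ H := InnerProductSpace.complexToReal
  set L : H →L[ℝ] H := K.restrictScalars ℝ - ContinuousLinearMap.id ℝ H with hLdef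
  have hL : ∀ x y, inner ℝ (L x) y = inner ℝ x (L y) := by
    intro x y
    have : inner ℝ (K x) y = inner ℝ x (K y) := congrArg Complex.re (hK.isSymmetric x y)
    simp only [hLdef, sub_apply, ContinuousLinearMap.coe_restrictScalars',
      ContinuousLinearMap.id_apply, inner_sub_left, inner_sub_right, this]
  set e : ℝ → ℝ := fun s => Real.exp (α * s) with he
  set F : ℝ → E := fun s => e s • ∫ r in (0 : ℝ)..s, Real.exp (-(α * r)) • y r with hF
  have hg : Continuous fun r => Real.exp (-(α * r)) • y r := by fun_prop
  have hFd : ∀ t, HasDerivAt F (α • F t + y t) t := by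
    intro t
    have h1 : HasDerivAt e (Real.exp (α * t) * α) t := by
      simpa using ((hasDerivAt_id t).const_mul α).exp
    refine (h1.smul (hg.integral_hasStrictDerivAt 0 t).hasDerivAt).congr_deriv ?_
    simp only [hF, he, smul_smul, ← Real.exp_add]
    rw [add_neg_cancel, Real.exp_zero, one_smul, mul_comm, add_comm]
  have hFc : Continuous F := continuous_iff_continuousAt.2 fun t => (hFd t).continuousAt
  set w : ℝ → H := fun t => Q (y 0) - L (Q (∫ s in (0 : ℝ)..t, y s)) -
    c • Q (∫ s in (0 : ℝ)..t, F s) with hw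
  have hwy : ∀ t, 0 ≤ t → w t = Q (y t) := by
    intro t ht
    have := heq t ht
    rw [memory_integral_eq] at this
    simp only [map_sub, map_add, map_smul] at this
    have hLK : L (Q (∫ s in (0 : ℝ)..t, y s)) =
      K (Q (∫ s in (0 : ℝ)..t, y s)) - Q (∫ s in (0 : ℝ)..t, y s) := rfl
    simp only [hw, hLK, ← this, hF, he]
    abel
  have hw0 : w 0 = 0 := by
    refine bounded_backward_uniqueness L hL (z := fun t => Q (F t)) hc ht₁ hlt hgap
      (α := α) ?_ ?_ ?_ ?_
    · intro t ht
      rw [hwy t ht]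
      have hd1 := L.hasFDerivAt.comp_hasDerivAt t
        (Q.hasFDerivAt.comp_hasDerivAt t (hy.integral_hasStrictDerivAt 0 t).hasDerivAt)
      have hd2 := (Q.hasFDerivAt.comp_hasDerivAt t
        (hFc.integral_hasStrictDerivAt 0 t).hasDerivAt).const_smul c
      refine (((hasDerivAt_const t (Q (y 0))).sub hd1).sub hd2).congr_deriv ?_
      simp
    · intro t ht
      rw [hwy t ht]
      refine (Q.hasFDerivAt.comp_hasDerivAt t (hFd t)).congr_deriv ?_
      simp
    · rw [hwy t₁ ht₁.le, h₁, map_zero]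
    · rw [hwy t₂ (ht₁.trans hlt).le, h₂, map_zero]
  rw [← hwy 0 le_rfl, hw0]

/-- Backward uniqueness for the memory equation `y' = A y - ∫ M(t - s) y(s) ds` in its mild form,
where `T` plays the role of the resolvent `(1 - A)⁻¹`, so that `A f = u` entails `T (f - u) = f`.
The embedding `ι` passes from a real space to a complex one, in which the functional calculus of `T`
is available. -/
theorem backward_uniqueness_of_resolvent (ι : E →L[ℝ] H) (hι : Function.Injective ι)
    (T : H →L[ℂ] H) (hT : IsSelfAdjoint T) (hTinj : ∀ x, T x = 0 → x = 0)
    {c α t₁ t₂ : ℝ} (hc : 0 < c) (ht₁ : 0 < t₁) (hlt : t₁ < t₂)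
    (hgap : t₂ - t₁ < Real.pi / Real.sqrt c) {y : ℝ → E} (hy : ContinuousOn y (Ici 0))
    (heq : ∀ t, 0 ≤ t → T (ι ((∫ s in (0 : ℝ)..t, y s) - (y t - y 0 +
      ∫ s in (0 : ℝ)..t, ∫ r in (0 : ℝ)..s, (c * Real.exp (α * (s - r))) • y r))) =
        ι (∫ s in (0 : ℝ)..t, y s))
    (h₁ : y t₁ = 0) (h₂ : y t₂ = 0) : y 0 = 0 := by
  -- Only the values at nonnegative times matter, so `y` may be taken to be continuous on `ℝ`.
  set v : ℝ → E := fun t => y (max t 0) with hv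
  have hvc : Continuous v := hy.comp_continuous (by fun_prop) fun t => le_max_right t 0
  have hvy : ∀ t, 0 ≤ t → v t = y t := fun t ht => by simp [hv, ht]
  have hint : ∀ (g : ℝ → ℝ) (t : ℝ), 0 ≤ t →
      ∫ s in (0 : ℝ)..t, g s • v s = ∫ s in (0 : ℝ)..t, g s • y s := by
    intro g t ht
    refine intervalIntegral.integral_congr fun s hs => ?_
    rw [uIcc_of_le ht] at hs
    simp only [hvy s hs.1]
  have hint1 : ∀ t : ℝ, 0 ≤ t → ∫ s in (0 : ℝ)..t, v s = ∫ s in (0 : ℝ)..t, y s := by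
    intro t ht
    simpa using hint (fun _ => 1) t ht
  have hint2 : ∀ t : ℝ, 0 ≤ t →
      ∫ s in (0 : ℝ)..t, ∫ r in (0 : ℝ)..s, (c * Real.exp (α * (s - r))) • v r =
      ∫ s in (0 : ℝ)..t, ∫ r in (0 : ℝ)..s, (c * Real.exp (α * (s - r))) • y r := by
    intro t ht
    refine intervalIntegral.integral_congr fun s hs => ?_
    rw [uIcc_of_le ht] at hs
    exact hint _ s hs.1
  have hbound : ∀ ε : ℝ, 0 < ε → ‖T (T (ι (y 0)))‖ ≤ ε * ‖ι (y 0)‖ := by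
    intro ε hε
    obtain ⟨P, K, hK, hKP, hPT⟩ := exists_spectral_truncation T hT hε
    have hP0 : P (ι (y 0)) = 0 := by
      rw [← hvy 0 le_rfl]
      refine truncated_initial_eq_zero ((P.restrictScalars ℝ).comp ι) K hK hc ht₁ hlt hgap hvc
        (α := α) (fun t ht => ?_) (by rw [hvy t₁ ht₁.le, h₁])
        (by rw [hvy t₂ (ht₁.trans hlt).le, h₂])
      rw [hint1 t ht, hint2 t ht, hvy t ht, hvy 0 le_rfl]
      change P (ι _) = K (P (ι _))
      rw [← heq t ht, hKP]
    have := (P - T ^ 2).le_of_opNorm_le hPT (ι (y 0))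
    rw [sub_apply, hP0, zero_sub, norm_neg] at this
    simpa [pow_two] using this
  have hTT : T (T (ι (y 0))) = 0 := by
    by_contra h
    have hpos : 0 < ‖T (T (ι (y 0)))‖ := norm_pos_iff.2 h
    have hle : ‖T (T (ι (y 0)))‖ ≤ 0 := by
      refine ge_of_tendsto (x := 𝓝[>] (0 : ℝ)) (f := fun ε => ε * ‖ι (y 0)‖) ?_
        (eventually_mem_nhdsWithin.mono hbound)
      have : Tendsto (fun ε : ℝ => ε * ‖ι (y 0)‖) (𝓝 0) (𝓝 (0 * ‖ι (y 0)‖)) :=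
        tendsto_id.mul_const _
      rw [zero_mul] at this
      exact this.mono_left nhdsWithin_le_nhds
    linarith
  exact (map_eq_zero_iff ι hι).1 (hTinj _ (hTinj _ hTT))

end SelfAdjoint

/-! ### The resolvent of the Dirichlet Laplacian -/

section Resolvent

variable {n : ℕ} {Ω : Set (Space n)}

/-- The complex Hilbert space `L²(Ω; ℂ)`. -/
abbrev L2C (Ω : Set (Space n)) : Type := Lp ℂ 2 (volume.restrict Ω)

/-- The embedding of `L²(Ω; ℝ)` into `L²(Ω; ℂ)`. The scalar action of `ℝ` on the target is the
restriction of that of `ℂ`, as in the abstract statements on complex Hilbert spaces; it agrees with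
the pointwise action, but not by definition. -/
def complexify (Ω : Set (Space n)) :
    letI : NormedSpace ℝ (L2C Ω) := NormedSpace.complexToReal
    L2 Ω →L[ℝ] L2C Ω :=
  letI : NormedSpace ℝ (L2C Ω) := NormedSpace.complexToReal
  { toFun := Complex.ofRealCLM.compLp
    map_add' := fun f g => (Complex.ofRealCLM.compLpL 2 (volume.restrict Ω)).map_add f g
    map_smul' := fun r f => by
      change Complex.ofRealCLM.compLp (r • f) = (r : ℂ) • Complex.ofRealCLM.compLp f
      refine Lp.ext ?_
      filter_upwards [Complex.ofRealCLM.coeFn_compLp (r • f), Complex.ofRealCLM.coeFn_compLp f,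
        Lp.coeFn_smul r f, Lp.coeFn_smul (r : ℂ) (Complex.ofRealCLM.compLp f)] with x h1 h2 h3 h4
      rw [h1, h3, h4, Pi.smul_apply, Pi.smul_apply, h2]
      simp
    cont := (Complex.ofRealCLM.compLpL 2 (volume.restrict Ω)).continuous }

theorem coeFn_complexify (f : L2 Ω) :
    complexify Ω f =ᵐ[volume.restrict Ω] fun x => (f x : ℂ) :=
  Complex.ofRealCLM.coeFn_compLp f

theorem complexify_injective : Function.Injective (complexify Ω) := by
  intro f g h
  refine Lp.ext ?_
  filter_upwards [coeFn_complexify f, coeFn_complexify g] with x h1 h2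
  rw [h] at h1
  exact Complex.ofReal_injective (h1.symm.trans h2)

theorem inner_complexify (f : L2 Ω) (x : L2C Ω) :
    inner ℂ (complexify Ω f) x = ∫ a in Ω, f a • x a := by
  rw [L2.inner_def]
  refine integral_congr_ae ?_
  filter_upwards [coeFn_complexify f] with a ha
  rw [ha]
  simp [mul_comm]

theorem inner_complexify_complexify (f g : L2 Ω) :
    inner ℂ (complexify Ω f) (complexify Ω g) = ((∫ a in Ω, f a * g a : ℝ) : ℂ) := by
  rw [inner_complexify, ← integral_complex_ofReal]
  refine integral_congr_ae ?_
  filter_upwards [coeFn_complexify g] with a ha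
  rw [ha]
  simp

/-- An `L²` function which is orthogonal to all test functions vanishes. -/
theorem eq_zero_of_forall_integral_testFunction {F : Type*} [NormedAddCommGroup F]
    [NormedSpace ℝ F] [CompleteSpace F] (hΩ : IsOpen Ω) (f : Lp F 2 (volume.restrict Ω))
    (h : ∀ φ, IsTestFunction Ω φ → ∫ x in Ω, φ x • f x = 0) : f = 0 := by
  have hloc : LocallyIntegrable f (volume.restrict Ω) :=
    (Lp.memLp f).locallyIntegrable (by norm_num)
  have := hΩ.ae_eq_zero_of_integral_contDiff_smul_eq_zero (hloc.locallyIntegrableOn Ω)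
    fun φ h1 h2 h3 => h φ ⟨h1, h2, h3⟩
  refine Lp.ext ?_
  filter_upwards [this, ae_restrict_mem hΩ.measurableSet, Lp.coeFn_zero F 2 (volume.restrict Ω)]
    with x h1 h2 h3
  rw [h1 h2, h3, Pi.zero_apply]

namespace IsTestFunction

variable {φ : Space n → ℝ}

theorem memLp (hφ : IsTestFunction Ω φ) : MemLp φ 2 (volume.restrict Ω) :=
  hφ.smooth.continuous.memLp_of_hasCompactSupport hφ.compact

theorem memLp_partialDeriv (hφ : IsTestFunction Ω φ) (i : Fin n) :
    MemLp (partialDeriv i φ) 2 (volume.restrict Ω) := by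
  refine Continuous.memLp_of_hasCompactSupport ?_ (hφ.compact.fderiv_apply ℝ _)
  exact (hφ.smooth.continuous_fderiv (by simp)).clm_apply continuous_const

/-- The class in `L²(Ω)` of a test function. -/
def toL2 (hφ : IsTestFunction Ω φ) : L2 Ω := hφ.memLp.toLp φ

/-- The class in `L²(Ω)` of a partial derivative of a test function. -/
def partialL2 (hφ : IsTestFunction Ω φ) (i : Fin n) : L2 Ω :=
  (hφ.memLp_partialDeriv i).toLp (partialDeriv i φ)

end IsTestFunction

theorem HasWeakPartial.unique (hΩ : IsOpen Ω) {i : Fin n} {f g g' : L2 Ω}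
    (h : HasWeakPartial Ω i f g) (h' : HasWeakPartial Ω i f g') : g = g' := by
  rw [← sub_eq_zero]
  refine eq_zero_of_forall_integral_testFunction hΩ _ fun φ hφ => ?_
  have hint : ∀ k : L2 Ω, Integrable (fun x => k x * φ x) (volume.restrict Ω) :=
    fun k => (Lp.memLp k).integrable_mul hφ.memLp
  have e1 : ∫ x in Ω, g x * φ x = ∫ x in Ω, g' x * φ x :=
    neg_injective ((h φ hφ).symm.trans (h' φ hφ))
  rw [← sub_eq_zero, ← integral_sub (hint g) (hint g')] at e1
  rw [← e1]
  refine integral_congr_ae ?_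
  filter_upwards [Lp.coeFn_sub g g'] with x hx
  rw [hx, Pi.sub_apply, smul_eq_mul]
  ring

/-- The Hilbert space `L²(Ω; ℂ)^{1 + n}` which contains `H¹(Ω; ℂ)` through `f ↦ (f, ∇ f)`: the
index `none` is that of the function, `some i` that of its `i`-th partial derivative. -/
abbrev Jet (Ω : Set (Space n)) : Type := PiLp 2 (fun _ : Option (Fin n) => L2C Ω)

/-- The element `(f, g)` of `L²(Ω; ℂ)^{1 + n}`, for real `f` and `g`. -/
def jet (f : L2 Ω) (g : Fin n → L2 Ω) : Jet Ω :=
  WithLp.toLp 2 fun o => complexify Ω (o.elim f g)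

/-- The space `H¹₀(Ω; ℂ)` as a closed subspace of `L²(Ω; ℂ)^{1 + n}`: the closure of the complex
span of the pairs `(φ, ∇ φ)`, for real test functions `φ`. -/
def jetH10 (Ω : Set (Space n)) : Submodule ℂ (Jet Ω) :=
  (Submodule.span ℂ {v | ∃ (φ : Space n → ℝ) (hφ : IsTestFunction Ω φ),
    v = jet hφ.toL2 hφ.partialL2}).topologicalClosure

instance : CompleteSpace (jetH10 Ω) :=
  (Submodule.isClosed_topologicalClosure _).completeSpace_coe

theorem jet_mem_jetH10 {φ : Space n → ℝ} (hφ : IsTestFunction Ω φ) :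
    jet hφ.toL2 hφ.partialL2 ∈ jetH10 Ω :=
  Submodule.le_topologicalClosure _ (Submodule.subset_span ⟨φ, hφ, rfl⟩)

theorem continuous_jet : Continuous fun p : L2 Ω × (Fin n → L2 Ω) => jet p.1 p.2 := by
  refine (PiLp.continuous_toLp 2 _).comp (continuous_pi fun o => ?_)
  refine (complexify Ω).continuous.comp ?_
  cases o with
  | none => exact continuous_fst
  | some i => exact (continuous_apply i).comp continuous_snd

theorem MemH10.exists_jet_mem {f : L2 Ω} (hf : MemH10 Ω f) :
    ∃ g : Fin n → L2 Ω, (∀ i, HasWeakPartial Ω i f (g i)) ∧ jet f g ∈ jetH10 Ω := by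
  obtain ⟨g, hg, φ, hφ, h0, h1⟩ := hf
  refine ⟨g, hg, ?_⟩
  have t0 : Tendsto (fun k => (hφ k).toL2) atTop (𝓝 f) := by
    rw [Lp.tendsto_Lp_iff_tendsto_eLpNorm']
    refine h0.congr fun k => eLpNorm_congr_ae ?_
    filter_upwards [(hφ k).memLp.coeFn_toLp] with x hx
    simp [IsTestFunction.toL2, hx]
  have t1 : Tendsto (fun k => (hφ k).partialL2) atTop (𝓝 g) := by
    rw [tendsto_pi_nhds]
    intro i
    rw [Lp.tendsto_Lp_iff_tendsto_eLpNorm']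
    refine (h1 i).congr fun k => eLpNorm_congr_ae ?_
    filter_upwards [((hφ k).memLp_partialDeriv i).coeFn_toLp] with x hx
    simp [IsTestFunction.partialL2, hx]
  exact (Submodule.isClosed_topologicalClosure _).mem_of_tendsto
    ((continuous_jet.tendsto (f, g)).comp (t0.prodMk_nhds t1))
    (Eventually.of_forall fun k => jet_mem_jetH10 (hφ k))

/-- The embedding `H¹₀(Ω; ℂ) → L²(Ω; ℂ)`. -/
def jetToL2 (Ω : Set (Space n)) : jetH10 Ω →L[ℂ] L2C Ω :=
  (PiLp.proj 2 (fun _ : Option (Fin n) => L2C Ω) none).comp (jetH10 Ω).subtypeL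

/-- The resolvent `(1 - Δ)⁻¹` of the Dirichlet Laplacian on `L²(Ω; ℂ)`. If `J` is the embedding of
`H¹₀` into `L²`, then `v = J† x` is the weak solution of `v - Δ v = x`, because
`⟪v, ψ⟫ + ⟪∇ v, ∇ ψ⟫ = ⟪x, ψ⟫` for all `ψ ∈ H¹₀`. -/
def resolvent (Ω : Set (Space n)) : L2C Ω →L[ℂ] L2C Ω :=
  (jetToL2 Ω).comp (ContinuousLinearMap.adjoint (jetToL2 Ω))

theorem isSelfAdjoint_resolvent : IsSelfAdjoint (resolvent Ω) := by
  rw [ContinuousLinearMap.isSelfAdjoint_iff', resolvent, ContinuousLinearMap.adjoint_comp,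
    ContinuousLinearMap.adjoint_adjoint]

theorem resolvent_injective (hΩ : IsOpen Ω) (x : L2C Ω) (hx : resolvent Ω x = 0) : x = 0 := by
  have h0 : ContinuousLinearMap.adjoint (jetToL2 Ω) x = 0 := by
    rw [← inner_self_eq_zero (𝕜 := ℂ), ContinuousLinearMap.adjoint_inner_left]
    change inner ℂ x (resolvent Ω x) = 0
    rw [hx, inner_zero_right]
  refine eq_zero_of_forall_integral_testFunction hΩ x fun φ hφ => ?_
  have h1 : inner ℂ (jetToL2 Ω ⟨_, jet_mem_jetH10 hφ⟩) x = 0 := by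
    rw [← ContinuousLinearMap.adjoint_inner_right, h0, inner_zero_right]
  change inner ℂ (complexify Ω hφ.toL2) x = 0 at h1
  rw [inner_complexify] at h1
  rw [← h1]
  refine integral_congr_ae ?_
  filter_upwards [hφ.memLp.coeFn_toLp] with a ha
  rw [IsTestFunction.toL2, ha]

/-- The operator `resolvent Ω` inverts `1 - Δ` on the domain `H² ∩ H¹₀` of the Dirichlet Laplacian:
integrating by parts against test functions identifies `(f, ∇ f)` with `J† (f - Δ f)`. -/
theorem resolvent_sub_laplacian (hΩ : IsOpen Ω) {f u : L2 Ω} (h : DirichletLaplacian Ω f u) :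
    resolvent Ω (complexify Ω (f - u)) = complexify Ω f := by
  obtain ⟨h10, g', k, hg', hk, rfl⟩ := h
  obtain ⟨g, hg, hmem⟩ := h10.exists_jet_mem
  obtain rfl : g = g' := funext fun i => (hg i).unique hΩ (hg' i)
  have key : ContinuousLinearMap.adjoint (jetToL2 Ω) (complexify Ω (f - ∑ i, k i i)) =
      ⟨jet f g, hmem⟩ := by
    refine ext_inner_right ℂ fun ψ => ?_
    rw [ContinuousLinearMap.adjoint_inner_left]
    refine ContinuousLinearMap.eqOn_closure_span
      (f := (innerSL ℂ (complexify Ω (f - ∑ i, k i i))).comp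
        (PiLp.proj 2 (fun _ : Option (Fin n) => L2C Ω) none))
      (g := innerSL ℂ (jet f g)) ?_ ψ.2
    rintro _ ⟨φ, hφ, rfl⟩
    change inner ℂ (complexify Ω (f - ∑ i, k i i)) (complexify Ω hφ.toL2) =
      inner ℂ (jet f g) (jet hφ.toL2 hφ.partialL2)
    rw [PiLp.inner_apply, Fintype.sum_option]
    change _ = inner ℂ (complexify Ω f) (complexify Ω hφ.toL2) +
      ∑ i, inner ℂ (complexify Ω (g i)) (complexify Ω (hφ.partialL2 i))
    have hparts : ∀ i, inner ℂ (complexify Ω (g i)) (complexify Ω (hφ.partialL2 i)) =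
        -inner ℂ (complexify Ω (k i i)) (complexify Ω hφ.toL2) := by
      intro i
      rw [inner_complexify_complexify, inner_complexify_complexify, ← Complex.ofReal_neg]
      congr 1
      refine Eq.trans (integral_congr_ae ?_) ((hk i i φ hφ).trans
        (congrArg Neg.neg (integral_congr_ae ?_)))
      · filter_upwards [(hφ.memLp_partialDeriv i).coeFn_toLp] with a ha
        rw [IsTestFunction.partialL2, ha]
      · filter_upwards [hφ.memLp.coeFn_toLp] with a ha
        rw [IsTestFunction.toL2, ha]
    rw [Finset.sum_congr rfl fun i _ => hparts i, Finset.sum_neg_distrib, map_sub, map_sum,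
      inner_sub_left, sum_inner, sub_eq_add_neg]
  change jetToL2 Ω (ContinuousLinearMap.adjoint (jetToL2 Ω) _) = _
  rw [key]
  rfl

end Resolvent

end HeatMemory

end

theorem mainTheorem8 (n : ℕ) (hn : 1 ≤ n) (Ω : Set (HeatMemory.Space n))
    (hΩ : HeatMemory.IsBoundedC2Domain Ω) (c α : ℝ) (hc : 0 < c) (t₁ t₂ : ℝ)
    (ht₁ : 0 < t₁) (ht₂ : 0 < t₂) (hlt : 0 < t₂ - t₁) (hgap : t₂ - t₁ < Real.pi / Real.sqrt c) :
    HeatMemory.HasBackwardUniqueness Ω (fun t : ℝ => c * Real.exp (α * t)) ![t₁, t₂] := by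
  intro y₀ y hy hzero
  obtain ⟨hcont, rfl, heq⟩ := hy
  exact HeatMemory.backward_uniqueness_of_resolvent (HeatMemory.complexify Ω)
    HeatMemory.complexify_injective (HeatMemory.resolvent Ω) HeatMemory.isSelfAdjoint_resolvent
    (HeatMemory.resolvent_injective hΩ.isOpen) hc ht₁ (sub_pos.1 hlt) hgap hcont
    (fun t ht => HeatMemory.resolvent_sub_laplacian hΩ.isOpen (heq t ht)) (hzero 0) (hzero 1)
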